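/- Throughout, a query algorithm on strings of $\Sigma^n$ is a probabilistic algorithm whose queries may be adaptive, that is, a probability distribution over decision trees; its query complexity is the maximal number of queries over all inputs and all outcomes of its internal randomness. A string $x\in\Sigma^n$ is $\varepsilon$-far from $\Pi\subseteq\Sigma^n$ if its relative Hamming distance from every element of $\Pi$ is larger than $\varepsilon$. An algorithm is an $\varepsilon$-tester for $\Pi$ if it accepts every $x\in\Pi$ with probability at least $2/3$ and rejects every $x\in\Sigma^n$ that is $\varepsilon$-far from $\Pi$ with probability at least $2/3$. A sample-based algorithm with sample complexity $s$ selects a random set $Q\subseteq[n]$ by including each coordinate independently with some fixed probability $p$; if $|Q|\le s$, then it reads $x|_Q$ and decides (possibly using further randomness) from $Q$ and $x|_Q$; if $|Q|>s$, then it makes no query, and its output does not depend on $x$. **Theorem.** There is an absolute constant $C>0$ such that for every $\varepsilon>0$ and every $q\in\mathbb N$ there is $n_0=n_0(\varepsilon,q)$ such that the following holds for all $n\ge n_0$ and every finite alphabet $\Sigma$ with $|\Sigma|^{n_0}\le n$ (in particular, for every fixed finite alphabet and all sufficiently large $n$). If a property $\Pi\subseteq\Sigma^n$ has an $\varepsilon/2$-tester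 that makes at most $q$ (possibly adaptive) queries, then $\Pi$ has a sample-based $\varepsilon$-tester with sample complexity at most $$n^{\,1-\frac{1}{C\,m^2\log^2 m}},\qquad m=\max\{q,2\}.$$ -/

import Mathlib

open scoped ENNReal NNReal

namespace LocalAlg

/-- A decision tree over strings `x : Fin n → A`: either it outputs a bit, or it queries a
coordinate and continues with a subtree that may depend on the value read (adaptivity). -/
inductive DecisionTree (n : ℕ) (A : Type*) where
  | leaf (b : Bool) : DecisionTree n A
  | query (i : Fin n) (next : A → DecisionTree n A) : DecisionTree n A

/-- The bit output by the decision tree on input `x`. -/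
def DecisionTree.eval {n : ℕ} {A : Type*} : DecisionTree n A → (Fin n → A) → Bool
  | .leaf b, _ => b
  | .query i next, x => (next (x i)).eval x

/-- The number of queries that the decision tree makes on input `x`. -/
def DecisionTree.numQueries {n : ℕ} {A : Type*} : DecisionTree n A → (Fin n → A) → ℕ
  | .leaf _, _ => 0
  | .query i next, x => (next (x i)).numQueries x + 1

/-- A probabilistic (adaptive) query algorithm: the internal randomness selects a decision tree. -/
abbrev QueryAlg (n : ℕ) (A : Type*) := PMF (DecisionTree n A)

/-- The distribution of the output of a query algorithm on input `x`. -/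
noncomputable def QueryAlg.output {n : ℕ} {A : Type*} (M : QueryAlg n A) (x : Fin n → A) :
    PMF Bool :=
  PMF.map (fun T => T.eval x) M

/-- The algorithm makes at most `q` queries, on every input and for every outcome of its
internal randomness. -/
def QueryAlg.QueryComplexityLE {n : ℕ} {A : Type*} (M : QueryAlg n A) (q : ℕ) : Prop :=
  ∀ T ∈ PMF.support M, ∀ x : Fin n → A, T.numQueries x ≤ q

/-- The random subset of `Fin n` that contains each element independently with probability `p`:
the set `Q` has probability `p ^ |Q| * (1 - p) ^ (n - |Q|)`. -/
noncomputable def randomSubset (n : ℕ) (p : ℝ≥0) (hp : p ≤ 1) : PMF (Finset (Fin n)) :=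
  PMF.ofFintype
    (fun Q => ((p ^ Q.card * (1 - p) ^ (n - Q.card) : ℝ≥0) : ℝ≥0∞)) (by
      have h : ∑ Q : Finset (Fin n), p ^ Q.card * (1 - p) ^ (n - Q.card) = 1 := by
        rw [Fin.sum_pow_mul_eq_add_pow, add_tsub_cancel_of_le hp, one_pow]
      exact_mod_cast h)

/-- A sample-based algorithm with a cap on the number of sampled coordinates. It selects a set `Q`
by including each coordinate independently with probability `p`. If `Q` has at most `cap` elements,
it queries exactly the coordinates in `Q` and decides (possibly using further randomness) from `Q`
and the restriction of the input to `Q`. Otherwise it makes no query and its output, drawn from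
`abort Q`, does not depend on the input. -/
structure SampleAlg (n : ℕ) (A : Type*) where
  p : ℝ≥0
  p_le_one : p ≤ 1
  cap : ℕ
  decide : (Q : Finset (Fin n)) → (Q → A) → PMF Bool
  abort : Finset (Fin n) → PMF Bool

/-- The distribution of the output of a sample-based algorithm on input `x`. -/
noncomputable def SampleAlg.output {n : ℕ} {A : Type*} (N : SampleAlg n A) (x : Fin n → A) :
    PMF Bool :=
  (randomSubset n N.p N.p_le_one).bind fun Q =>
    if Q.card ≤ N.cap then N.decide Q (fun i => x i) else N.abort Q

open scoped Classical in
/-- The relative Hamming distance between two strings of length `n`. -/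
noncomputable def relDist {n : ℕ} {A : Type*} (x y : Fin n → A) : ℝ :=
  (hammingDist x y : ℝ) / n

/-- `x` is `ε`-far from `Π`: its relative distance from every element of `Π` exceeds `ε`. -/
def IsFar {n : ℕ} {A : Type*} (ε : ℝ) (P : Set (Fin n → A)) (x : Fin n → A) : Prop :=
  ∀ y ∈ P, ε < relDist x y

/-- `out x` is the distribution of the output of a probabilistic algorithm on input `x`. The
algorithm is an `ε`-tester for the property `P` (with two-sided error `1/3`) if it accepts every
element of `P`, and rejects every string that is `ε`-far from `P`, with probability at
least `2/3`. -/
def IsTester {n : ℕ} {A : Type*} (ε : ℝ) (P : Set (Fin n → A)) (out : (Fin n → A) → PMF Bool) :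
    Prop :=
  (∀ x ∈ P, 2 / 3 ≤ out x true) ∧ (∀ x, IsFar ε P x → 2 / 3 ≤ out x false)

/-- `P` is `ε`-testable with `q` (possibly adaptive) queries. -/
def Testable {n : ℕ} {A : Type*} (ε : ℝ) (q : ℕ) (P : Set (Fin n → A)) : Prop :=
  ∃ M : QueryAlg n A, M.QueryComplexityLE q ∧ IsTester ε P M.output

/-- `P` has a sample-based `ε`-tester that always samples at most `s` coordinates. -/
def SampleTestable {n : ℕ} {A : Type*} (ε : ℝ) (s : ℝ) (P : Set (Fin n → A)) : Prop :=
  ∃ N : SampleAlg n A, (N.cap : ℝ) ≤ s ∧ IsTester ε P N.output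

end LocalAlg

/-! A random set containing each coordinate with probability p contains a fixed set of k queries
with probability p^k, so weighting the captured executions by inverse probabilities estimates the
acceptance probability without bias. The estimate concentrates only if no coordinate is queried too
often. Frequently queried coordinates are therefore put into a small kernel, over whose values the
sampler maximizes; a far string stays far when it changes on a small kernel. Soundness needs a union
bound over all kernel assignments, and a single frequency threshold leaves no room for it: a
threshold θ gives a kernel of size about 1/θ, while the tail exponent is also about 1/θ before the
loss from p.

The remedy is a chain of k + 2 thresholds, successive ones differing by a factor n^(1/(k+1)), with
descending sets H j of heavy coordinates. At most k queries miss one of the k + 1 annuli H j \ H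
(j+1) (`exists_disjoint_annulus`), so for some j the executions that miss annulus j carry a 1/(k+1)
share of the acceptance probability. In this class the kernel is H (j+1), while queries outside it
even avoid H j. The resulting gap n^(1/(k+1)) in the tail exponent pays for the loss p^(-2k) in the
bounded differences inequality if p = n^(-1/(4k(k+1))); `QueryModel.sampleTestable` carries this
out.

Since classes only get a 1/(k+1) share, the tester is first amplified to error 1/(4(k+1)) by O(log
m) votes. Hence k = O(m log m), which gives the exponent. -/

namespace LocalAlg

/-! ### Random subsets and the bounded differences inequality. -/

section SubsetExpectation

variable {ι : Type*}

/-- The expectation of `f Q` over a random subset `Q` of `s` that contains each element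
independently with probability `p`. -/
noncomputable def subsetExp (p : ℝ) (s : Finset ι) (f : Finset ι → ℝ) : ℝ :=
  ∑ Q ∈ s.powerset, p ^ Q.card * (1 - p) ^ (s.card - Q.card) * f Q

theorem subsetExp_mono {p : ℝ} (h0 : 0 ≤ p) (h1 : p ≤ 1) {s : Finset ι} {f g : Finset ι → ℝ}
    (h : ∀ Q, f Q ≤ g Q) : subsetExp p s f ≤ subsetExp p s g := by
  unfold subsetExp
  refine Finset.sum_le_sum fun Q _ => mul_le_mul_of_nonneg_left (h Q) ?_
  have : 0 ≤ 1 - p := by linarith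
  positivity

theorem subsetExp_add (p : ℝ) (s : Finset ι) (f g : Finset ι → ℝ) :
    subsetExp p s (fun Q => f Q + g Q) = subsetExp p s f + subsetExp p s g := by
  simp only [subsetExp, mul_add, Finset.sum_add_distrib]

theorem subsetExp_const_mul (p : ℝ) (s : Finset ι) (c : ℝ) (f : Finset ι → ℝ) :
    subsetExp p s (fun Q => c * f Q) = c * subsetExp p s f := by
  simp only [subsetExp, Finset.mul_sum]
  exact Finset.sum_congr rfl fun Q _ => by ring

theorem subsetExp_sum {κ : Type*} (p : ℝ) (s : Finset ι) (t : Finset κ)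
    (f : κ → Finset ι → ℝ) :
    subsetExp p s (fun Q => ∑ j ∈ t, f j Q) = ∑ j ∈ t, subsetExp p s (f j) := by
  simp only [subsetExp, Finset.mul_sum]
  exact Finset.sum_comm

open scoped Classical in
/-- The probability that a random subset of `s`, which contains each element independently with
probability `p`, satisfies `E`. -/
noncomputable def subsetProb (p : ℝ) (s : Finset ι) (E : Finset ι → Prop) : ℝ :=
  subsetExp p s (fun Q => if E Q then 1 else 0)

theorem subsetProb_le_exp {p : ℝ} (h0 : 0 ≤ p) (h1 : p ≤ 1) {s : Finset ι}
    {E : Finset ι → Prop} {f : Finset ι → ℝ} (hf : ∀ Q, 0 ≤ f Q) (h : ∀ Q, E Q → 1 ≤ f Q) :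
    subsetProb p s E ≤ subsetExp p s f := by
  refine subsetExp_mono h0 h1 fun Q => ?_
  split_ifs with hE
  exacts [h Q hE, hf Q]

theorem subsetProb_mono {p : ℝ} (h0 : 0 ≤ p) (h1 : p ≤ 1) {s : Finset ι}
    {E F : Finset ι → Prop} (h : ∀ Q, E Q → F Q) : subsetProb p s E ≤ subsetProb p s F := by
  refine subsetExp_mono h0 h1 fun Q => ?_
  by_cases hE : E Q
  · simp [hE, h Q hE]
  · simp only [hE, if_false]
    split_ifs <;> norm_num

theorem subsetProb_or_le {p : ℝ} (h0 : 0 ≤ p) (h1 : p ≤ 1) {s : Finset ι}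
    (E F : Finset ι → Prop) :
    subsetProb p s (fun Q => E Q ∨ F Q) ≤ subsetProb p s E + subsetProb p s F := by
  unfold subsetProb
  rw [← subsetExp_add]
  refine subsetExp_mono h0 h1 fun Q => ?_
  by_cases hE : E Q <;> by_cases hF : F Q <;> simp [hE, hF]

theorem subsetProb_exists_le {κ : Type*} {p : ℝ} (h0 : 0 ≤ p) (h1 : p ≤ 1) {s : Finset ι}
    (t : Finset κ) (E : κ → Finset ι → Prop) :
    subsetProb p s (fun Q => ∃ j ∈ t, E j Q) ≤ ∑ j ∈ t, subsetProb p s (E j) := by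
  classical
  unfold subsetProb
  rw [← subsetExp_sum]
  refine subsetExp_mono h0 h1 fun Q => ?_
  split_ifs with h
  · obtain ⟨j, hj, hE⟩ := h
    refine le_trans ?_ (Finset.single_le_sum (fun i _ => ?_) hj)
    · simp [hE]
    · split_ifs <;> norm_num
  · refine Finset.sum_nonneg fun i _ => ?_
    split_ifs <;> norm_num

variable [DecidableEq ι]

/-- Conditioning on whether `a` is selected; this drives the induction in `subsetExp_exp_le`. -/
theorem subsetExp_insert (p : ℝ) {a : ι} {s : Finset ι} (ha : a ∉ s) (f : Finset ι → ℝ) :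
    subsetExp p (insert a s) f =
      subsetExp p s (fun Q => (1 - p) * f Q + p * f (insert a Q)) := by
  unfold subsetExp
  rw [Finset.sum_powerset_insert ha, ← Finset.sum_add_distrib]
  refine Finset.sum_congr rfl fun Q hQ => ?_
  have hQs : Q ⊆ s := Finset.mem_powerset.1 hQ
  have haQ : a ∉ Q := fun h => ha (hQs h)
  rw [Finset.card_insert_of_notMem ha, Finset.card_insert_of_notMem haQ]
  have hc := Finset.card_le_card hQs
  rw [show s.card + 1 - Q.card = (s.card - Q.card) + 1 by omega,
    show s.card + 1 - (Q.card + 1) = s.card - Q.card by omega]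
  ring

/-- A fixed set `U` is contained in the random subset with probability `p ^ |U|`. -/
theorem subsetExp_subset (p : ℝ) {s U : Finset ι} (hU : U ⊆ s) :
    subsetExp p s (fun Q => if U ⊆ Q then 1 else 0) = p ^ U.card := by
  -- In the expansion of this product over subsets `Q`, the factor 0 on `U` kills every `Q` that
  -- misses a point of `U`.
  have h := Finset.prod_add (fun _ : ι => p) (fun i => if i ∈ U then 0 else 1 - p) s
  have hl : ∏ i ∈ s, (p + if i ∈ U then 0 else 1 - p) = p ^ U.card := by
    rw [← Finset.prod_subset hU (f := fun i => p + if i ∈ U then 0 else 1 - p)]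
    · rw [Finset.prod_congr rfl (g := fun _ => p) (fun i hi => by simp [hi]), Finset.prod_const]
    · intro i _ hi
      simp [hi]
  rw [← hl, h, subsetExp]
  refine Finset.sum_congr rfl fun Q hQ => ?_
  have hQs : Q ⊆ s := Finset.mem_powerset.1 hQ
  rw [Finset.prod_const, mul_assoc]
  congr 1
  split_ifs with hc
  · rw [Finset.prod_congr rfl (g := fun _ => 1 - p), Finset.prod_const,
      Finset.card_sdiff_of_subset hQs, mul_one]
    intro i hi
    rw [if_neg]
    exact fun hiU => (Finset.mem_sdiff.1 hi).2 (hc hiU)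
  · obtain ⟨i, hiU, hiQ⟩ := Finset.not_subset.1 hc
    rw [mul_zero]
    exact (Finset.prod_eq_zero (Finset.mem_sdiff.2 ⟨hU hiU, hiQ⟩) (by simp [hiU])).symm

theorem subsetExp_const (p : ℝ) (s : Finset ι) (c : ℝ) : subsetExp p s (fun _ => c) = c := by
  have h := subsetExp_subset p (Finset.empty_subset s)
  simp only [Finset.empty_subset, if_true, Finset.card_empty, pow_zero] at h
  have h2 := subsetExp_const_mul p s c (fun _ => 1)
  rw [h] at h2
  simpa using h2

/-- The moment generating function bound for a variable with two values. -/
theorem two_point_mgf {p : ℝ} (h0 : 0 ≤ p) (h1 : p ≤ 1) {a b c : ℝ} (h : |b - a| ≤ c) :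
    (1 - p) * Real.exp a + p * Real.exp b ≤
      Real.exp ((1 - p) * a + p * b + c ^ 2 / 2) := by
  have hp : 0 ≤ 1 - p := by linarith
  -- Symmetrization: by Jensen, E exp(X) · exp(-E X) is at most E exp(X - X') for an independent
  -- copy X', and this is a convex combination of 1 and cosh(b - a).
  have hJ : Real.exp (-((1 - p) * a + p * b)) ≤ (1 - p) * Real.exp (-a) + p * Real.exp (-b) := by
    have := convexOn_exp.2 (Set.mem_univ (-a)) (Set.mem_univ (-b)) hp h0 (by ring)
    simp only [smul_eq_mul] at this
    rwa [show (1 - p) * -a + p * -b = -((1 - p) * a + p * b) by ring] at this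
  have hab : Real.exp a * Real.exp (-a) = 1 := by rw [← Real.exp_add]; simp
  have hbb : Real.exp b * Real.exp (-b) = 1 := by rw [← Real.exp_add]; simp
  have hcosh : Real.exp a * Real.exp (-b) + Real.exp b * Real.exp (-a) =
      2 * Real.cosh (b - a) := by
    rw [Real.cosh_eq, ← Real.exp_add, ← Real.exp_add, neg_sub, sub_eq_add_neg, sub_eq_add_neg]
    ring
  have hc1 : 1 ≤ Real.cosh (b - a) := Real.one_le_cosh _
  have hc2 : Real.cosh (b - a) ≤ Real.exp (c ^ 2 / 2) := by
    refine (Real.cosh_le_exp_half_sq _).trans (Real.exp_le_exp.2 ?_)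
    have := sq_le_sq' (by linarith [(abs_nonneg (b - a))]) h
    rw [sq_abs] at this
    linarith
  have hprod : ((1 - p) * Real.exp a + p * Real.exp b) *
      ((1 - p) * Real.exp (-a) + p * Real.exp (-b)) ≤ Real.exp (c ^ 2 / 2) := by
    have : ((1 - p) * Real.exp a + p * Real.exp b) *
        ((1 - p) * Real.exp (-a) + p * Real.exp (-b)) =
        (1 - p) ^ 2 + p ^ 2 + 2 * (p * (1 - p)) * Real.cosh (b - a) := by
      linear_combination (1 - p) ^ 2 * hab + p ^ 2 * hbb + p * (1 - p) * hcosh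
    rw [this]
    nlinarith [mul_nonneg h0 hp]
  have hpos : 0 ≤ (1 - p) * Real.exp a + p * Real.exp b := by positivity
  have h3 := (mul_le_mul_of_nonneg_left hJ hpos).trans hprod
  rw [Real.exp_neg, ← div_eq_mul_inv, div_le_iff₀ (Real.exp_pos _), ← Real.exp_add] at h3
  rwa [add_comm (c ^ 2 / 2)] at h3

/-- The moment generating function bound behind the bounded differences inequality. -/
theorem subsetExp_exp_le {p : ℝ} (h0 : 0 ≤ p) (h1 : p ≤ 1) (s : Finset ι) (c : ι → ℝ)
    (f : Finset ι → ℝ) (hf : ∀ Q, ∀ i ∈ s, |f (insert i Q) - f Q| ≤ c i) :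
    subsetExp p s (fun Q => Real.exp (f Q)) ≤
      Real.exp (subsetExp p s f + (∑ i ∈ s, c i ^ 2) / 2) := by
  induction s using Finset.induction_on generalizing f with
  | empty => simp [subsetExp]
  | insert a s ha ih =>
    have hp : 0 ≤ 1 - p := by linarith
    rw [subsetExp_insert p ha, subsetExp_insert p ha, Finset.sum_insert ha]
    -- Averaging out `a` costs `c a ^ 2 / 2` in the exponent, and `g` inherits the other difference
    -- bounds as an average of functions that satisfy them.
    set g : Finset ι → ℝ := fun Q => (1 - p) * f Q + p * f (insert a Q) with hg
    calc _ ≤ subsetExp p s (fun Q => Real.exp (c a ^ 2 / 2) * Real.exp (g Q)) := by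
          refine subsetExp_mono h0 h1 fun Q => ?_
          rw [← Real.exp_add, add_comm (c a ^ 2 / 2)]
          exact two_point_mgf h0 h1 (hf Q a (Finset.mem_insert_self a s))
      _ = Real.exp (c a ^ 2 / 2) * subsetExp p s (fun Q => Real.exp (g Q)) :=
          subsetExp_const_mul _ _ _ _
      _ ≤ Real.exp (c a ^ 2 / 2) * Real.exp (subsetExp p s g + (∑ i ∈ s, c i ^ 2) / 2) := by
          refine mul_le_mul_of_nonneg_left (ih g fun Q i hi => ?_) (Real.exp_pos _).le
          have e1 := hf Q i (Finset.mem_insert_of_mem hi)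
          have e2 := hf (insert a Q) i (Finset.mem_insert_of_mem hi)
          rw [Finset.insert_comm] at e2
          rw [abs_le] at e1 e2 ⊢
          simp only [hg]
          constructor <;> nlinarith
      _ = _ := by rw [← Real.exp_add]; ring_nf

/-- The bounded differences inequality, upper tail. -/
theorem subsetProb_upper_tail {p : ℝ} (h0 : 0 ≤ p) (h1 : p ≤ 1) (s : Finset ι) (c : ι → ℝ)
    (f : Finset ι → ℝ) (hf : ∀ Q, ∀ i ∈ s, |f (insert i Q) - f Q| ≤ c i) {V η : ℝ}
    (hV : 0 < V) (hcV : ∑ i ∈ s, c i ^ 2 ≤ V) (hη : 0 ≤ η) :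
    subsetProb p s (fun Q => subsetExp p s f + η ≤ f Q) ≤ Real.exp (-(η ^ 2 / (2 * V))) := by
  -- The minimizer of the Chernoff exponent `-lam * η + lam ^ 2 * V / 2`.
  set lam := η / V with hlam
  have hl : 0 ≤ lam := by positivity
  have hm := subsetExp_exp_le h0 h1 s (fun i => lam * c i) (fun Q => lam * f Q) (by
    intro Q i hi
    rw [← mul_sub, abs_mul, abs_of_nonneg hl]
    exact mul_le_mul_of_nonneg_left (hf Q i hi) hl)
  rw [subsetExp_const_mul] at hm
  set μ := subsetExp p s f
  calc subsetProb p s (fun Q => μ + η ≤ f Q)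
      ≤ subsetExp p s (fun Q => Real.exp (-(lam * (μ + η))) * Real.exp (lam * f Q)) := by
        refine subsetProb_le_exp h0 h1 (fun Q => by positivity) fun Q hQ => ?_
        rw [← Real.exp_add]
        refine Real.one_le_exp ?_
        have := mul_le_mul_of_nonneg_left hQ hl
        linarith
    _ = Real.exp (-(lam * (μ + η))) * subsetExp p s (fun Q => Real.exp (lam * f Q)) :=
        subsetExp_const_mul _ _ _ _
    _ ≤ Real.exp (-(lam * (μ + η))) *
          Real.exp (lam * μ + (∑ i ∈ s, (lam * c i) ^ 2) / 2) :=
        mul_le_mul_of_nonneg_left hm (Real.exp_pos _).le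
    _ ≤ Real.exp (-(η ^ 2 / (2 * V))) := by
        rw [← Real.exp_add]
        refine Real.exp_le_exp.2 ?_
        simp only [mul_pow, ← Finset.mul_sum]
        have e1 : lam ^ 2 * ∑ i ∈ s, c i ^ 2 ≤ lam ^ 2 * V :=
          mul_le_mul_of_nonneg_left hcV (by positivity)
        have e2 : lam ^ 2 * V = η ^ 2 / V := by rw [hlam]; field_simp
        have e3 : lam * η = η ^ 2 / V := by rw [hlam]; field_simp
        have e4 : η ^ 2 / (2 * V) = η ^ 2 / V / 2 := by field_simp
        rw [e4]
        linarith

/-- The bounded differences inequality, lower tail. -/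
theorem subsetProb_lower_tail {p : ℝ} (h0 : 0 ≤ p) (h1 : p ≤ 1) (s : Finset ι) (c : ι → ℝ)
    (f : Finset ι → ℝ) (hf : ∀ Q, ∀ i ∈ s, |f (insert i Q) - f Q| ≤ c i) {V η : ℝ}
    (hV : 0 < V) (hcV : ∑ i ∈ s, c i ^ 2 ≤ V) (hη : 0 ≤ η) :
    subsetProb p s (fun Q => f Q ≤ subsetExp p s f - η) ≤ Real.exp (-(η ^ 2 / (2 * V))) := by
  have h := subsetProb_upper_tail h0 h1 s c (fun Q => -1 * f Q) (by
    intro Q i hi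
    rw [← mul_sub, abs_mul]
    simpa using hf Q i hi) hV hcV hη
  rw [subsetExp_const_mul] at h
  refine le_trans (subsetProb_mono h0 h1 fun Q hQ => ?_) h
  linarith

/-- Markov's inequality for the cardinality of the random subset. -/
theorem subsetProb_card_le {p : ℝ} (h0 : 0 ≤ p) (h1 : p ≤ 1) (s : Finset ι) {t : ℝ}
    (ht : 0 < t) : subsetProb p s (fun Q => t ≤ (Q ∩ s).card) ≤ s.card * p / t := by
  have hcard : ∀ Q : Finset ι, ((Q ∩ s).card : ℝ) = ∑ i ∈ s, if {i} ⊆ Q then (1 : ℝ) else 0 := by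
    intro Q
    simp only [Finset.singleton_subset_iff, Finset.sum_boole, Finset.inter_comm Q s]
    norm_cast
  calc subsetProb p s (fun Q => t ≤ (Q ∩ s).card)
      ≤ subsetExp p s (fun Q => t⁻¹ * ∑ i ∈ s, if {i} ⊆ Q then (1 : ℝ) else 0) := by
        refine subsetProb_le_exp h0 h1 (fun Q => ?_) fun Q hQ => ?_
        · rw [← hcard]; positivity
        · rw [← hcard, inv_mul_eq_div, le_div_iff₀ ht]
          linarith
    _ = s.card * p / t := by
        rw [subsetExp_const_mul, subsetExp_sum,
          Finset.sum_congr rfl fun i hi => subsetExp_subset p (Finset.singleton_subset_iff.2 hi)]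
        simp [div_eq_inv_mul]

end SubsetExpectation

/-! ### Finite models of query algorithms and amplification by majority. -/

section QueryModel

variable {n : ℕ} {A : Type*}

/-- The set of coordinates that a decision tree queries on input `x`. -/
def DecisionTree.queried : DecisionTree n A → (Fin n → A) → Finset (Fin n)
  | .leaf _, _ => ∅
  | .query i next, x => insert i ((next (x i)).queried x)

theorem DecisionTree.card_queried_le (T : DecisionTree n A) (x : Fin n → A) :
    (T.queried x).card ≤ T.numQueries x := by
  induction T with
  | leaf b => simp [queried]
  | query i next ih =>
    exact (Finset.card_insert_le _ _).trans (Nat.succ_le_succ (ih (x i)))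

theorem DecisionTree.queried_congr (T : DecisionTree n A) (x y : Fin n → A)
    (h : ∀ i ∈ T.queried x, y i = x i) : T.queried y = T.queried x ∧ T.eval y = T.eval x := by
  induction T with
  | leaf b => exact ⟨rfl, rfl⟩
  | query i next ih =>
    have hi : y i = x i := h i (Finset.mem_insert_self _ _)
    obtain ⟨h1, h2⟩ := ih (x i) fun j hj => h j (Finset.mem_insert_of_mem hj)
    constructor
    · simp only [queried, hi, h1]
    · simp only [eval, hi, h2]

/-- A decision tree of depth `q` queries, over all inputs, at most `q * |A| ^ q` coordinates. -/
theorem DecisionTree.card_biUnion_queried_le [Fintype A] (T : DecisionTree n A)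
    (X : Finset (Fin n → A)) (q : ℕ) (h : ∀ x ∈ X, T.numQueries x ≤ q) :
    (X.biUnion T.queried).card ≤ q * Fintype.card A ^ q := by
  classical
  -- The subtree for the answer `a` is depth-bounded only on inputs with `x i = a`, hence the
  -- induction over all input sets `X`.
  induction T generalizing X q with
  | leaf b =>
    have : (X.biUnion (DecisionTree.leaf b : DecisionTree n A).queried) = ∅ := by
      ext; simp [queried]
    simp [this]
  | query i next ih =>
    rcases X.eq_empty_or_nonempty with rfl | ⟨x₀, hx₀⟩
    · simp
    obtain ⟨r, rfl⟩ : ∃ r, q = r + 1 :=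
      ⟨q - 1, by have h' := h x₀ hx₀; simp only [numQueries] at h'; omega⟩
    have hA : 0 < Fintype.card A := Fintype.card_pos_iff.2 ⟨x₀ i⟩
    have hsub : X.biUnion (DecisionTree.query i next).queried ⊆
        insert i (Finset.univ.biUnion fun a : A =>
          (X.filter fun x => x i = a).biUnion (next a).queried) := by
      intro j hj
      simp only [Finset.mem_biUnion, queried, Finset.mem_insert] at hj
      obtain ⟨x, hx, rfl | hj⟩ := hj
      · exact Finset.mem_insert_self _ _
      · refine Finset.mem_insert_of_mem ?_
        simp only [Finset.mem_biUnion, Finset.mem_univ, true_and, Finset.mem_filter]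
        exact ⟨x i, x, ⟨hx, rfl⟩, hj⟩
    have hbr : ∀ a : A, ((X.filter fun x => x i = a).biUnion (next a).queried).card ≤
        r * Fintype.card A ^ r := by
      intro a
      refine ih a _ r fun x hx => ?_
      obtain ⟨hxX, rfl⟩ := Finset.mem_filter.1 hx
      exact Nat.le_of_succ_le_succ (h x hxX)
    calc _ ≤ _ := Finset.card_le_card hsub
      _ ≤ _ := Finset.card_insert_le _ _
      _ ≤ Fintype.card A * (r * Fintype.card A ^ r) + 1 := by
          refine Nat.succ_le_succ (Finset.card_biUnion_le.trans ?_)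
          exact (Finset.sum_le_card_nsmul _ _ _ fun a _ => hbr a).trans (by simp)
      _ ≤ (r + 1) * Fintype.card A ^ (r + 1) := by
          have := Nat.one_le_pow (r + 1) _ hA
          rw [add_mul, pow_succ] at *
          nlinarith

/-- A query algorithm with finitely many outcomes of its internal randomness, described by the set
of queried coordinates and the answer on each input. -/
structure QueryModel (Ω : Type*) [Fintype Ω] (n : ℕ) (A : Type*) where
  weight : Ω → ℝ
  weight_nonneg : ∀ ω, 0 ≤ weight ω
  sum_weight : ∑ ω, weight ω = 1
  queries : Ω → (Fin n → A) → Finset (Fin n)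
  answer : Ω → (Fin n → A) → Bool
  congr : ∀ ω x y, (∀ i ∈ queries ω x, y i = x i) →
    queries ω y = queries ω x ∧ answer ω y = answer ω x

/-- The probability that the output on input `x` is `b`. -/
def QueryModel.prob {Ω : Type*} [Fintype Ω] (m : QueryModel Ω n A) (x : Fin n → A) (b : Bool) :
    ℝ :=
  ∑ ω, if m.answer ω x = b then m.weight ω else 0

/-- All coordinates that may be queried for the outcome `ω` of the internal randomness. -/
def QueryModel.reach {Ω : Type*} [Fintype Ω] [Fintype A] (m : QueryModel Ω n A) (ω : Ω) :
    Finset (Fin n) :=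
  Finset.univ.biUnion (m.queries ω)

/-- The possible behaviours of a decision tree that makes at most `q` queries. -/
def TreeBehaviour (n : ℕ) (A : Type*) [Fintype A] (q : ℕ) : Type _ :=
  {τ : (Fin n → A) → Finset (Fin n) × Bool //
    (∀ x y, (∀ i ∈ (τ x).1, y i = x i) → τ y = τ x) ∧ (∀ x, (τ x).1.card ≤ q) ∧
      (Finset.univ.biUnion fun x => (τ x).1).card ≤ q * Fintype.card A ^ q}

noncomputable instance (n : ℕ) (A : Type*) [Fintype A] (q : ℕ) :
    Fintype (TreeBehaviour n A q) := by
  classical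
  unfold TreeBehaviour
  exact Fintype.ofFinite _

open scoped Classical in
/-- The behaviour of a decision tree; trees that make too many queries get a default value. -/
noncomputable def DecisionTree.behaviour [Fintype A] (q : ℕ) (T : DecisionTree n A) :
    TreeBehaviour n A q :=
  if h : ∀ x, T.numQueries x ≤ q then
    ⟨fun x => (T.queried x, T.eval x),
      fun x y hxy => Prod.ext (T.queried_congr x y hxy).1 (T.queried_congr x y hxy).2,
      fun x => (T.card_queried_le x).trans (h x),
      T.card_biUnion_queried_le _ q fun x _ => h x⟩
  else ⟨fun _ => (∅, false), fun _ _ _ => rfl, fun _ => by simp, by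
      exact Finset.card_biUnion_le.trans (by simp)⟩

theorem DecisionTree.behaviour_answer [Fintype A] {q : ℕ} {T : DecisionTree n A}
    (h : ∀ x, T.numQueries x ≤ q) (x : Fin n → A) : ((T.behaviour q).1 x).2 = T.eval x := by
  simp [behaviour, h]

/-- The finite model of a query algorithm that makes at most `q` queries. -/
noncomputable def QueryAlg.model [Fintype A] (M : QueryAlg n A) (q : ℕ) :
    QueryModel (TreeBehaviour n A q) n A where
  weight τ := (PMF.map (DecisionTree.behaviour q) M τ).toReal
  weight_nonneg _ := ENNReal.toReal_nonneg
  sum_weight := by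
    rw [← ENNReal.toReal_sum fun τ _ => PMF.apply_ne_top _ _, ← tsum_fintype (L := .unconditional _), PMF.tsum_coe]
    rfl
  queries τ x := (τ.1 x).1
  answer τ x := (τ.1 x).2
  congr τ x y h := by simp [τ.2.1 x y h]

/-- The default behaviour is assigned only to trees outside the support of `M`, which have
probability zero. -/
theorem QueryAlg.model_prob [Fintype A] {M : QueryAlg n A} {q : ℕ} (hM : M.QueryComplexityLE q)
    (x : Fin n → A) (b : Bool) : (M.model q).prob x b = (M.output x b).toReal := by
  have hmap : M.output x =
      PMF.map (fun τ : TreeBehaviour n A q => (τ.1 x).2) (PMF.map (DecisionTree.behaviour q) M) := by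
    rw [PMF.map_comp, QueryAlg.output]
    simp only [PMF.map]
    ext c
    simp only [PMF.bind_apply]
    refine tsum_congr fun T => ?_
    by_cases hT : T ∈ PMF.support M
    · simp [DecisionTree.behaviour_answer (hM T hT)]
    · rw [PMF.mem_support_iff, not_not] at hT
      simp [hT]
  rw [hmap, PMF.map_apply, tsum_fintype, ENNReal.toReal_sum]
  · refine Finset.sum_congr rfl fun τ _ => ?_
    by_cases hτ : (τ.1 x).2 = b
    · simp only [QueryAlg.model, hτ, if_true]
    · rw [if_neg (Ne.symm hτ), ENNReal.toReal_zero]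
      exact if_neg hτ
  · intro τ _
    split_ifs
    · exact PMF.apply_ne_top _ _
    · simp

theorem QueryModel.prob_add {Ω : Type*} [Fintype Ω] (m : QueryModel Ω n A) (x : Fin n → A)
    (b : Bool) : m.prob x b + m.prob x (!b) = 1 := by
  rw [QueryModel.prob, QueryModel.prob, ← Finset.sum_add_distrib, ← m.sum_weight]
  refine Finset.sum_congr rfl fun ω _ => ?_
  cases b <;> cases m.answer ω x <;> simp

/-- The majority vote over `2 * u` independent executions. -/
def QueryModel.majority {Ω : Type*} [Fintype Ω] (m : QueryModel Ω n A) (u : ℕ) :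
    QueryModel (Fin (2 * u) → Ω) n A where
  weight ω := ∏ k, m.weight (ω k)
  weight_nonneg ω := Finset.prod_nonneg fun k _ => m.weight_nonneg _
  sum_weight := by
    classical
    have h := Finset.prod_univ_sum (fun _ : Fin (2 * u) => (Finset.univ : Finset Ω))
      (fun _ ω => m.weight ω)
    rw [Fintype.piFinset_univ] at h
    rw [← h]
    simp [m.sum_weight]
  queries ω x := Finset.univ.biUnion fun k => m.queries (ω k) x
  answer ω x := decide (u ≤ (Finset.univ.filter fun k => m.answer (ω k) x = true).card)
  congr ω x y h := by
    have hk : ∀ k, m.queries (ω k) y = m.queries (ω k) x ∧ m.answer (ω k) y = m.answer (ω k) x :=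
      fun k => m.congr (ω k) x y fun i hi =>
        h i (Finset.mem_biUnion.2 ⟨k, Finset.mem_univ k, hi⟩)
    simp only [fun k => (hk k).1, fun k => (hk k).2, and_self]

theorem QueryModel.majority_card_queries_le {Ω : Type*} [Fintype Ω] {m : QueryModel Ω n A}
    {q : ℕ} (h : ∀ ω x, (m.queries ω x).card ≤ q) (u : ℕ) (ω : Fin (2 * u) → Ω)
    (x : Fin n → A) : ((m.majority u).queries ω x).card ≤ 2 * u * q :=
  Finset.card_biUnion_le.trans
    ((Finset.sum_le_card_nsmul _ _ _ fun k _ => h (ω k) x).trans (by simp))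

theorem QueryModel.majority_card_reach_le {Ω : Type*} [Fintype Ω] [Fintype A]
    {m : QueryModel Ω n A} {B : ℕ} (h : ∀ ω, (m.reach ω).card ≤ B) (u : ℕ)
    (ω : Fin (2 * u) → Ω) : ((m.majority u).reach ω).card ≤ 2 * u * B := by
  have hsub : (m.majority u).reach ω ⊆ Finset.univ.biUnion fun k => m.reach (ω k) := by
    intro i hi
    simp only [reach, majority, Finset.mem_biUnion, Finset.mem_univ, true_and] at hi ⊢
    obtain ⟨x, k, hi⟩ := hi
    exact ⟨k, x, hi⟩
  exact (Finset.card_le_card hsub).trans (Finset.card_biUnion_le.trans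
    ((Finset.sum_le_card_nsmul _ _ _ fun k _ => h (ω k)).trans (by simp)))

/-- The majority vote errs with exponentially small probability. -/
theorem QueryModel.majority_prob_le {Ω : Type*} [Fintype Ω] {m : QueryModel Ω n A}
    {x : Fin n → A} {b : Bool} (h : 2 / 3 ≤ m.prob x b) (u : ℕ) :
    (m.majority u).prob x (!b) ≤ (8 / 9) ^ u := by
  classical
  -- Exponential Markov with 2^(number of wrong votes): one vote contributes at most 2/3 + 2 · 1/3 =
  -- 4/3, and (4/3)^(2u) / 2^u = (8/9)^u.
  set g : Ω → ℝ := fun ω => m.weight ω * if m.answer ω x = b then 1 else 2 with hg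
  have hgn : ∀ ω, 0 ≤ g ω := fun ω => mul_nonneg (m.weight_nonneg ω) (by split_ifs <;> norm_num)
  have hgs : ∑ ω, g ω ≤ 4 / 3 := by
    have : ∑ ω, g ω = m.prob x b + 2 * m.prob x (!b) := by
      simp only [QueryModel.prob, hg, Finset.mul_sum, ← Finset.sum_add_distrib]
      refine Finset.sum_congr rfl fun ω _ => ?_
      cases b <;> cases m.answer ω x <;> simp [mul_comm]
    linarith [m.prob_add x b]
  have hpt : ∀ ω : Fin (2 * u) → Ω,
      (if (m.majority u).answer ω x = !b then (m.majority u).weight ω else 0) ≤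
        (1 / 2) ^ u * ∏ k, g (ω k) := by
    intro ω
    split_ifs with hω
    -- Ties are accepted, but for either value of `b` a wrong majority needs at least `u` wrong
    -- votes.
    · have hcount : u ≤ (Finset.univ.filter fun k => ¬ m.answer (ω k) x = b).card := by
        have htot := Finset.card_filter_add_card_filter_not
          (s := (Finset.univ : Finset (Fin (2 * u)))) (fun k => m.answer (ω k) x = true)
        rw [Finset.card_univ, Fintype.card_fin] at htot
        cases b
        · simpa [QueryModel.majority] using hω
        · simp only [QueryModel.majority, Bool.not_true, decide_eq_false_iff_not, not_le] at hω
          omega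
      have hprod : ∏ k, g (ω k) = (m.majority u).weight ω *
          2 ^ (Finset.univ.filter fun k => ¬ m.answer (ω k) x = b).card := by
        simp only [hg, Finset.prod_mul_distrib, QueryModel.majority]
        congr 1
        rw [Finset.prod_ite]
        simp
      have hw := (m.majority u).weight_nonneg ω
      have h2 : (2 : ℝ) ^ u ≤ 2 ^ (Finset.univ.filter fun k => ¬ m.answer (ω k) x = b).card :=
        pow_le_pow_right₀ (by norm_num) hcount
      rw [hprod]
      calc (m.majority u).weight ω = (1 / 2) ^ u * ((m.majority u).weight ω * 2 ^ u) := by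
            rw [mul_comm ((m.majority u).weight ω), ← mul_assoc, ← mul_pow]; norm_num
        _ ≤ _ := by gcongr
    · exact mul_nonneg (by positivity) (Finset.prod_nonneg fun k _ => hgn _)
  have hsum := Finset.prod_univ_sum (fun _ : Fin (2 * u) => (Finset.univ : Finset Ω))
      (fun _ ω => g ω)
  rw [Fintype.piFinset_univ] at hsum
  calc (m.majority u).prob x (!b) ≤ ∑ ω : Fin (2 * u) → Ω, (1 / 2) ^ u * ∏ k, g (ω k) :=
        Finset.sum_le_sum fun ω _ => hpt ω
    _ = (1 / 2) ^ u * (∑ ω, g ω) ^ (2 * u) := by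
        rw [← Finset.mul_sum, ← hsum]; simp
    _ ≤ (1 / 2) ^ u * (4 / 3) ^ (2 * u) := by
        have := Finset.sum_nonneg fun ω (_ : ω ∈ Finset.univ) => hgn ω
        gcongr
    _ = (8 / 9) ^ u := by rw [pow_mul, ← mul_pow]; norm_num

end QueryModel

/-! ### Kernels, annuli and the sample-based estimate. -/

section Daisies

variable {n : ℕ} {A : Type*} {Ω : Type*} [Fintype Ω]

/-- The probability of accepting `y` with queries that avoid the annulus `H \ K`. -/
noncomputable def QueryModel.acceptProb (m : QueryModel Ω n A) (H K : Finset (Fin n))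
    (y : Fin n → A) : ℝ :=
  ∑ ω, if m.answer ω y = true ∧ Disjoint (m.queries ω y) (H \ K) then m.weight ω else 0

/-- The estimate of `acceptProb` from a random set `Q` of coordinates. It only uses the outcomes
whose queries outside of the kernel `K` are contained in `Q`. -/
noncomputable def QueryModel.estimate (m : QueryModel Ω n A) (p : ℝ) (H K : Finset (Fin n))
    (y : Fin n → A) (Q : Finset (Fin n)) : ℝ :=
  ∑ ω, (if m.answer ω y = true ∧ Disjoint (m.queries ω y) (H \ K) then
    m.weight ω * p⁻¹ ^ (m.queries ω y \ K).card else 0) *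
      if m.queries ω y \ K ⊆ Q then 1 else 0

theorem QueryModel.acceptProb_le_prob (m : QueryModel Ω n A) (H K : Finset (Fin n))
    (y : Fin n → A) : m.acceptProb H K y ≤ m.prob y true := by
  refine Finset.sum_le_sum fun ω _ => ?_
  have := m.weight_nonneg ω
  split_ifs <;> simp_all

/-- The weight `p⁻¹ ^ |queries \ K|` cancels the probability that these queries are sampled. -/
theorem QueryModel.subsetExp_estimate (m : QueryModel Ω n A) {p : ℝ} (hp : p ≠ 0)
    (H K : Finset (Fin n)) (y : Fin n → A) :
    subsetExp p Finset.univ (m.estimate p H K y) = m.acceptProb H K y := by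
  unfold estimate acceptProb
  rw [subsetExp_sum]
  refine Finset.sum_congr rfl fun ω _ => ?_
  rw [subsetExp_const_mul, subsetExp_subset p (Finset.subset_univ _)]
  split_ifs
  · rw [mul_assoc, ← mul_pow, inv_mul_cancel₀ hp, one_pow, mul_one]
  · rw [zero_mul]

/-- Only executions that query inside `K ∪ Q` contribute, and these cannot distinguish `y` from `z`.
Hence the sample and a kernel assignment determine the estimate. -/
theorem QueryModel.estimate_congr (m : QueryModel Ω n A) (p : ℝ) (H K Q : Finset (Fin n))
    {y z : Fin n → A} (h : ∀ i, i ∈ K ∨ i ∈ Q → y i = z i) :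
    m.estimate p H K y Q = m.estimate p H K z Q := by
  refine Finset.sum_congr rfl fun ω _ => ?_
  have key : ∀ y z : Fin n → A, (∀ i, i ∈ K ∨ i ∈ Q → y i = z i) → m.queries ω y \ K ⊆ Q →
      m.queries ω z = m.queries ω y ∧ m.answer ω z = m.answer ω y := by
    intro y z h hQ
    refine m.congr ω y z fun i hi => (h i ?_).symm
    by_cases hK : i ∈ K
    · exact Or.inl hK
    · exact Or.inr (hQ (Finset.mem_sdiff.2 ⟨hi, hK⟩))
  by_cases hy : m.queries ω y \ K ⊆ Q
  · obtain ⟨h1, h2⟩ := key y z h hy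
    rw [h1, h2]
  · by_cases hz : m.queries ω z \ K ⊆ Q
    · obtain ⟨h1, h2⟩ := key z y (fun i hi => (h i hi).symm) hz
      rw [h1, h2]
    · rw [if_neg hy, if_neg hz, mul_zero, mul_zero]

/-- The effect of coordinate `i` on the estimate for the input `y`. -/
noncomputable def QueryModel.influence (m : QueryModel Ω n A) (p : ℝ) (k : ℕ)
    (H : Finset (Fin n)) (y : Fin n → A) (i : Fin n) : ℝ :=
  if i ∈ H then 0 else p⁻¹ ^ k * ∑ ω, if i ∈ m.queries ω y then m.weight ω else 0

/-- Sampling `i` matters only to executions that query `i` outside `K`. Those that count avoid `H \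
K`, so then `i ∉ H`; this is why heavy coordinates have influence zero. -/
theorem QueryModel.abs_estimate_sub_le {m : QueryModel Ω n A} {k : ℕ}
    (hk : ∀ ω x, (m.queries ω x).card ≤ k) {p : ℝ} (h0 : 0 < p) (h1 : p ≤ 1)
    (H K : Finset (Fin n)) (y : Fin n → A) (Q : Finset (Fin n)) (i : Fin n) :
    |m.estimate p H K y (insert i Q) - m.estimate p H K y Q| ≤ m.influence p k H y i := by
  have hp : 1 ≤ p⁻¹ := (one_le_inv₀ h0).2 h1
  have hif : m.influence p k H y i = ∑ ω, if i ∈ m.queries ω y ∧ i ∉ H then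
      p⁻¹ ^ k * m.weight ω else 0 := by
    unfold influence
    by_cases hi : i ∈ H
    · simp [hi]
    · simp [hi, Finset.mul_sum]
  rw [hif, estimate, estimate, ← Finset.sum_sub_distrib]
  refine (Finset.abs_sum_le_sum_abs _ _).trans (Finset.sum_le_sum fun ω _ => ?_)
  have hw := m.weight_nonneg ω
  have hrhs : 0 ≤ if i ∈ m.queries ω y ∧ i ∉ H then p⁻¹ ^ k * m.weight ω else 0 := by
    split_ifs
    · positivity
    · exact le_rfl
  rw [← mul_sub, abs_mul]
  by_cases hc : m.answer ω y = true ∧ Disjoint (m.queries ω y) (H \ K)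
  swap
  · rw [if_neg hc]; simpa using hrhs
  by_cases hi : i ∈ m.queries ω y \ K
  swap
  · have : m.queries ω y \ K ⊆ insert i Q ↔ m.queries ω y \ K ⊆ Q :=
      Finset.subset_insert_iff_of_notMem hi
    simp only [this, sub_self, abs_zero, mul_zero]
    exact hrhs
  · have hiH : i ∉ H := fun hiH => Finset.disjoint_left.1 hc.2 (Finset.mem_sdiff.1 hi).1
      (Finset.mem_sdiff.2 ⟨hiH, (Finset.mem_sdiff.1 hi).2⟩)
    have hiq : i ∈ m.queries ω y ∧ i ∉ H := ⟨(Finset.mem_sdiff.1 hi).1, hiH⟩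
    rw [if_pos hc, if_pos hiq, abs_of_nonneg (by positivity)]
    have hpow : p⁻¹ ^ (m.queries ω y \ K).card ≤ p⁻¹ ^ k :=
      pow_le_pow_right₀ hp ((Finset.card_le_card Finset.sdiff_subset).trans (hk ω y))
    have hone : |(if m.queries ω y \ K ⊆ insert i Q then (1 : ℝ) else 0) -
        if m.queries ω y \ K ⊆ Q then 1 else 0| ≤ 1 := by
      split_ifs <;> norm_num
    calc _ ≤ m.weight ω * p⁻¹ ^ (m.queries ω y \ K).card * 1 :=
          mul_le_mul_of_nonneg_left hone (by positivity)
      _ ≤ p⁻¹ ^ k * m.weight ω := by rw [mul_one, mul_comm]; gcongr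

/-- A set of at most `k` elements avoids one of the `k + 1` annuli of a descending chain. -/
theorem exists_disjoint_annulus {ι : Type*} [DecidableEq ι] {H : ℕ → Finset ι} (hH : Antitone H)
    {k : ℕ} {S : Finset ι} (hS : S.card ≤ k) :
    ∃ j ∈ Finset.range (k + 1), Disjoint S (H j \ H (j + 1)) := by
  by_contra! hcon
  simp only [Finset.not_disjoint_iff] at hcon
  obtain ⟨i₀, -⟩ := hcon 0 (by simp)
  have : Nonempty ι := ⟨i₀⟩
  choose! f hfS hf using hcon
  -- Different annuli of a descending chain are disjoint, so meeting all of them takes `k + 1`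
  -- distinct points.
  have hinj : Set.InjOn f {j | j ∈ Finset.range (k + 1)} := by
    have hlt : ∀ a ∈ Finset.range (k + 1), ∀ b ∈ Finset.range (k + 1), a < b → f a ≠ f b := by
      intro a ha b hb hab heq
      have h1 := (Finset.mem_sdiff.1 (hf a ha)).2
      have h2 := (Finset.mem_sdiff.1 (hf b hb)).1
      rw [← heq] at h2
      exact h1 (hH hab h2)
    intro a ha b hb heq
    rcases lt_trichotomy a b with h | h | h
    · exact absurd heq (hlt a ha b hb h)
    · exact h
    · exact absurd heq.symm (hlt b hb a ha h)
  have := Finset.card_le_card_of_injOn f hfS hinj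
  rw [Finset.card_range] at this
  omega

theorem QueryModel.prob_le_sum_acceptProb {m : QueryModel Ω n A} {k : ℕ}
    (hk : ∀ ω x, (m.queries ω x).card ≤ k) {H : ℕ → Finset (Fin n)} (hH : Antitone H)
    (y : Fin n → A) :
    m.prob y true ≤ ∑ j ∈ Finset.range (k + 1), m.acceptProb (H j) (H (j + 1)) y := by
  unfold acceptProb prob
  rw [Finset.sum_comm]
  refine Finset.sum_le_sum fun ω _ => ?_
  have hnn : ∀ j ∈ Finset.range (k + 1), 0 ≤ if m.answer ω y = true ∧
      Disjoint (m.queries ω y) (H j \ H (j + 1)) then m.weight ω else 0 := fun j _ => by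
    split_ifs
    exacts [m.weight_nonneg ω, le_rfl]
  split_ifs with ha
  · obtain ⟨j, hj, hd⟩ := exists_disjoint_annulus hH (hk ω y)
    refine le_trans ?_ (Finset.single_le_sum hnn hj)
    simp [ha, hd]
  · exact Finset.sum_nonneg hnn

/-- If the algorithm decides correctly outside of an event of probability at most `1 / 3`, then
its output is correct with probability at least `2 / 3`. -/
theorem SampleAlg.le_output (N : SampleAlg n A) (x : Fin n → A) (b : Bool)
    (E : Finset (Fin n) → Prop) (hE : subsetProb N.p Finset.univ E ≤ 1 / 3)
    (h : ∀ Q, ¬ E Q → Q.card ≤ N.cap ∧ N.decide Q (fun i => x i) = PMF.pure b) :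
    2 / 3 ≤ N.output x b := by
  classical
  have hp1 : (N.p : ℝ) ≤ 1 := by exact_mod_cast N.p_le_one
  have hsplit : subsetProb N.p Finset.univ E +
      subsetExp N.p Finset.univ (fun Q => if E Q then 0 else 1) = 1 := by
    rw [subsetProb, ← subsetExp_add]
    refine Eq.trans ?_ (subsetExp_const (N.p : ℝ) (Finset.univ : Finset (Fin n)) 1)
    congr 1
    funext Q
    split_ifs <;> norm_num
  have hreal : ENNReal.ofReal (2 / 3) ≤
      ENNReal.ofReal (subsetExp N.p Finset.univ (fun Q => if E Q then 0 else 1)) :=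
    ENNReal.ofReal_le_ofReal (by linarith)
  have h23 : ENNReal.ofReal (2 / 3) = 2 / 3 := by
    rw [ENNReal.ofReal_div_of_pos (by norm_num)]; norm_num
  rw [h23] at hreal
  refine hreal.trans ?_
  have hnn : 0 ≤ 1 - (N.p : ℝ) := by linarith
  rw [subsetExp, ENNReal.ofReal_sum_of_nonneg, SampleAlg.output, PMF.bind_apply, tsum_fintype,
    Finset.powerset_univ]
  · refine Finset.sum_le_sum fun Q _ => ?_
    by_cases hQ : E Q
    · simp [hQ]
    · obtain ⟨h1, h2⟩ := h Q hQ
      rw [if_neg hQ, if_pos h1, h2]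
      simp only [PMF.pure_apply, if_true, mul_one, randomSubset, PMF.ofFintype_apply,
        Finset.card_univ, Fintype.card_fin]
      refine le_of_eq ?_
      rw [ENNReal.ofReal, ENNReal.coe_inj]
      ext
      rw [Real.coe_toNNReal _ (by positivity)]
      push_cast [NNReal.coe_sub N.p_le_one]
      rfl
  · intro Q _
    refine mul_nonneg (by positivity) ?_
    split_ifs <;> norm_num

/-- Changing a far string on a small set of coordinates leaves it far. -/
theorem IsFar.of_eq_off {ε δ : ℝ} {P : Set (Fin n → A)} {x y : Fin n → A} (hx : IsFar ε P x)
    (K : Finset (Fin n)) (hK : K.card ≤ δ * n) (hδ : 0 ≤ δ) (hy : ∀ i ∉ K, y i = x i) :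
    IsFar (ε - δ) P y := by
  classical
  intro z hz
  have h1 := hx z hz
  unfold relDist at h1 ⊢
  have h2 : hammingDist x y ≤ K.card := by
    refine Finset.card_le_card fun i hi => ?_
    by_contra hiK
    simp [hy i hiK] at hi
  have h3 : hammingDist x z ≤ K.card + hammingDist y z :=
    (hammingDist_triangle x y z).trans (Nat.add_le_add_right h2 _)
  have h4 : (hammingDist x z : ℝ) / n ≤ (K.card : ℝ) / n + (hammingDist y z : ℝ) / n := by
    rw [← add_div]
    gcongr
    exact_mod_cast h3
  have h5 : (K.card : ℝ) / n ≤ δ := div_le_of_le_mul₀ (Nat.cast_nonneg n) hδ hK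
  have h6 : ε < (hammingDist x z : ℝ) / n := by convert h1
  have h7 : ε - δ < (hammingDist y z : ℝ) / n := by linarith
  convert h7

/-- For one of the classes of queries and for some assignment to its kernel, the estimate of the
acceptance probability from `Q` and the values `z` reaches the threshold `τ`. -/
def QueryModel.Reaches (m : QueryModel Ω n A) (p : ℝ) (L : ℕ) (H : ℕ → Finset (Fin n)) (τ : ℝ)
    (Q : Finset (Fin n)) (z : Q → A) : Prop :=
  ∃ j ∈ Finset.range L, ∃ y : Fin n → A,
    (∀ i : Q, (i : Fin n) ∉ H (j + 1) → y i = z i) ∧ τ ≤ m.estimate p (H j) (H (j + 1)) y Q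

open scoped Classical in
/-- The sample-based algorithm that accepts if the estimate reaches a threshold. -/
noncomputable def QueryModel.sampler (m : QueryModel Ω n A) (p : ℝ≥0) (hp : p ≤ 1) (cap L : ℕ)
    (H : ℕ → Finset (Fin n)) (τ : ℝ) : SampleAlg n A where
  p := p
  p_le_one := hp
  cap := cap
  decide Q z := PMF.pure (decide (m.Reaches p L H τ Q z))
  abort _ := PMF.pure false

variable [Fintype A]

/-- The probability that coordinate `i` is queried on some input. -/
noncomputable def QueryModel.touch (m : QueryModel Ω n A) (i : Fin n) : ℝ :=
  ∑ ω, if i ∈ m.reach ω then m.weight ω else 0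

/-- The sum is the expected size of `reach`. Counting queries over all inputs makes the heavy sets
independent of the input, at the price that `B` involves a power of the alphabet size. -/
theorem QueryModel.sum_touch_le {m : QueryModel Ω n A} {B : ℕ}
    (h : ∀ ω, (m.reach ω).card ≤ B) : ∑ i, m.touch i ≤ B := by
  unfold touch
  rw [Finset.sum_comm]
  calc _ = ∑ ω, ((m.reach ω).card : ℝ) * m.weight ω := by
        refine Finset.sum_congr rfl fun ω _ => ?_
        rw [← Finset.sum_filter, Finset.sum_const, nsmul_eq_mul]
        simp
    _ ≤ ∑ ω, (B : ℝ) * m.weight ω := Finset.sum_le_sum fun ω _ =>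
        mul_le_mul_of_nonneg_right (by exact_mod_cast h ω) (m.weight_nonneg ω)
    _ = B := by rw [← Finset.mul_sum, m.sum_weight, mul_one]

theorem QueryModel.touch_nonneg (m : QueryModel Ω n A) (i : Fin n) : 0 ≤ m.touch i := by
  refine Finset.sum_nonneg fun ω _ => ?_
  split_ifs
  exacts [m.weight_nonneg ω, le_rfl]

open scoped Classical in
/-- The coordinates that are queried on some input with probability more than `θ`. -/
noncomputable def QueryModel.heavy (m : QueryModel Ω n A) (θ : ℝ) : Finset (Fin n) :=
  Finset.univ.filter fun i => θ < m.touch i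

theorem QueryModel.touch_le_of_notMem_heavy {m : QueryModel Ω n A} {θ : ℝ} {i : Fin n}
    (h : i ∉ m.heavy θ) : m.touch i ≤ θ := by
  simpa [heavy] using h

theorem QueryModel.heavy_anti (m : QueryModel Ω n A) : Antitone m.heavy := by
  intro θ θ' h i hi
  simp only [heavy, Finset.mem_filter, Finset.mem_univ, true_and] at hi ⊢
  exact h.trans_lt hi

theorem QueryModel.card_heavy_mul_le {m : QueryModel Ω n A} {B : ℕ}
    (h : ∀ ω, (m.reach ω).card ≤ B) (θ : ℝ) : (m.heavy θ).card * θ ≤ B := by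
  calc (m.heavy θ).card * θ = ∑ i ∈ m.heavy θ, θ := by simp
    _ ≤ ∑ i ∈ m.heavy θ, m.touch i := Finset.sum_le_sum fun i hi => by
        simp only [heavy, Finset.mem_filter] at hi
        exact hi.2.le
    _ ≤ ∑ i, m.touch i := Finset.sum_le_sum_of_subset_of_nonneg (Finset.subset_univ _)
        fun i _ _ => m.touch_nonneg i
    _ ≤ B := m.sum_touch_le h

/-- A sum of squares is at most the maximum times the sum: off `H` each query probability is at most
`θ`, and on a fixed input they add up to at most `k`, with no factor from the alphabet. -/
theorem QueryModel.sum_influence_sq_le {m : QueryModel Ω n A} {k : ℕ}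
    (hk : ∀ ω x, (m.queries ω x).card ≤ k) {p : ℝ} (h0 : 0 < p) {H : Finset (Fin n)} {θ : ℝ}
    (hθ : 0 ≤ θ) (hH : ∀ i ∉ H, m.touch i ≤ θ) (y : Fin n → A) :
    ∑ i, m.influence p k H y i ^ 2 ≤ (p⁻¹ ^ k) ^ 2 * (θ * k) := by
  set a : Fin n → ℝ := fun i => ∑ ω, if i ∈ m.queries ω y then m.weight ω else 0 with ha
  have ha0 : ∀ i, 0 ≤ a i := fun i => Finset.sum_nonneg fun ω _ => by
    split_ifs
    exacts [m.weight_nonneg ω, le_rfl]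
  have hat : ∀ i, a i ≤ m.touch i := fun i => Finset.sum_le_sum fun ω _ => by
    have hw := m.weight_nonneg ω
    by_cases hi : i ∈ m.queries ω y
    · have : i ∈ m.reach ω := Finset.mem_biUnion.2 ⟨y, Finset.mem_univ y, hi⟩
      simp [hi, this]
    · rw [if_neg hi]
      split_ifs
      exacts [hw, le_rfl]
  have hsum : ∑ i, a i ≤ k := by
    simp only [ha]
    rw [Finset.sum_comm]
    calc _ = ∑ ω, ((m.queries ω y).card : ℝ) * m.weight ω := by
          refine Finset.sum_congr rfl fun ω _ => ?_
          rw [← Finset.sum_filter, Finset.sum_const, nsmul_eq_mul]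
          simp
      _ ≤ ∑ ω, (k : ℝ) * m.weight ω := Finset.sum_le_sum fun ω _ =>
          mul_le_mul_of_nonneg_right (by exact_mod_cast hk ω y) (m.weight_nonneg ω)
      _ = k := by rw [← Finset.mul_sum, m.sum_weight, mul_one]
  calc _ ≤ ∑ i, (p⁻¹ ^ k) ^ 2 * (θ * a i) := Finset.sum_le_sum fun i _ => by
        unfold influence
        have := ha0 i
        split_ifs with hi
        · rw [zero_pow two_ne_zero]; positivity
        · rw [mul_pow]
          refine mul_le_mul_of_nonneg_left ?_ (by positivity)
          rw [sq]
          exact mul_le_mul_of_nonneg_right ((hat i).trans (hH i hi)) (ha0 i)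
    _ = (p⁻¹ ^ k) ^ 2 * (θ * ∑ i, a i) := by rw [← Finset.mul_sum, ← Finset.mul_sum]
    _ ≤ _ := by gcongr

/-- Failure is split evenly: 1/6 for an oversized sample and 1/6 for bad estimates. Completeness
needs one lower tail; soundness needs upper tails for all classes and kernel assignments. -/
theorem QueryModel.sampleTestable [Nonempty A] (m : QueryModel Ω n A) {k : ℕ}
    (hk : ∀ ω x, (m.queries ω x).card ≤ k) (hk0 : 0 < k) {H : ℕ → Finset (Fin n)}
    (hH : Antitone H) {θ : ℕ → ℝ} (hθ0 : ∀ j, 0 < θ j) (hθ : ∀ j, ∀ i ∉ H j, m.touch i ≤ θ j)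
    {p : ℝ≥0} (hp0 : 0 < p) (hp1 : p ≤ 1) {cap : ℕ} {ε : ℝ} (hε : 0 ≤ ε) {P : Set (Fin n → A)}
    (hcap : (n : ℝ) * p / (cap + 1) ≤ 1 / 6)
    (htail : ∀ j ∈ Finset.range (k + 1), (Fintype.card A : ℝ) ^ (H (j + 1)).card *
      Real.exp (-((1 / (4 * (k + 1) : ℝ)) ^ 2 / (2 * (((p : ℝ)⁻¹ ^ k) ^ 2 * (θ j * k))))) ≤
        1 / (6 * (k + 1)))
    (hsmall : ∀ j ∈ Finset.range (k + 1), ((H (j + 1)).card : ℝ) ≤ ε / 2 * n)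
    (hacc : ∀ x ∈ P, m.prob x false ≤ 1 / (4 * (k + 1)))
    (hrej : ∀ x, IsFar (ε / 2) P x → m.prob x true ≤ 1 / (4 * (k + 1)))
    {s : ℝ} (hs : (cap : ℝ) ≤ s) : SampleTestable ε s P := by
  classical
  have hp0' : (0 : ℝ) < p := by exact_mod_cast hp0
  have hp1' : (p : ℝ) ≤ 1 := by exact_mod_cast hp1
  have hk0' : (0 : ℝ) < k := by exact_mod_cast hk0
  have hL : (0 : ℝ) < k + 1 := by positivity
  set V : ℕ → ℝ := fun j => ((p : ℝ)⁻¹ ^ k) ^ 2 * (θ j * k) with hV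
  have hV0 : ∀ j, 0 < V j := fun j => by have := hθ0 j; positivity
  set η : ℝ := 1 / (4 * (k + 1)) with hη
  have hη0 : 0 ≤ η := by positivity
  -- Halfway between `3 * η`, reached by some class on members of `P`, and `η`, which bounds every
  -- class on far strings.
  set τ : ℝ := 2 * η with hτ
  have hsize : subsetProb (p : ℝ) (Finset.univ : Finset (Fin n)) (fun Q => cap < Q.card) ≤
      1 / 6 := by
    refine le_trans ?_ hcap
    have h := subsetProb_card_le hp0'.le hp1' (Finset.univ : Finset (Fin n))
      (t := (cap : ℝ) + 1) (by positivity)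
    rw [Finset.card_univ, Fintype.card_fin] at h
    refine le_trans (subsetProb_mono hp0'.le hp1' fun Q hQ => ?_) h
    rw [Finset.inter_univ]
    exact_mod_cast hQ
  refine ⟨m.sampler p hp1 cap (k + 1) H τ, hs, fun x hx => ?_, fun x hx => ?_⟩
  · obtain ⟨j, hj, hjx⟩ : ∃ j ∈ Finset.range (k + 1),
        3 * η ≤ m.acceptProb (H j) (H (j + 1)) x := by
      by_contra! hcon
      have h1 := m.prob_le_sum_acceptProb hk hH x
      have h2 := Finset.sum_lt_sum_of_nonempty (Finset.nonempty_range_iff.2 k.succ_ne_zero) hcon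
      rw [Finset.sum_const, Finset.card_range, nsmul_eq_mul] at h2
      have h3 := m.prob_add x true
      have h4 := hacc x hx
      have h5 : ((k + 1 : ℕ) : ℝ) * (3 * η) = 3 / 4 := by
        rw [hη]; push_cast; field_simp
      have h6 : η ≤ 1 / 4 := by
        rw [hη]; gcongr; linarith
      simp only [Bool.not_true] at h3
      linarith
    refine SampleAlg.le_output _ x true (fun Q => cap < Q.card ∨
      m.estimate p (H j) (H (j + 1)) x Q ≤
        subsetExp p Finset.univ (m.estimate p (H j) (H (j + 1)) x) - η) ?_ fun Q hQ => ?_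
    · refine (subsetProb_or_le hp0'.le hp1' _ _).trans ?_
      have h1 := subsetProb_lower_tail hp0'.le hp1' Finset.univ
        (m.influence p k (H j) x) (m.estimate p (H j) (H (j + 1)) x)
        (fun Q i _ => m.abs_estimate_sub_le hk hp0' hp1' _ _ x Q i)
        (hV0 j) (m.sum_influence_sq_le hk hp0' (hθ0 j).le (hθ j) x) hη0
      have h2 := htail j hj
      have h3 : (1 : ℝ) ≤ (Fintype.card A : ℝ) ^ (H (j + 1)).card :=
        one_le_pow₀ (by exact_mod_cast Fintype.card_pos)
      have h4 := le_mul_of_one_le_left (Real.exp_pos (-(η ^ 2 / (2 * V j)))).le h3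
      have h5 : 1 / (6 * (k + 1 : ℝ)) ≤ 1 / 6 := by gcongr; linarith
      have h6 : subsetProb ((m.sampler p hp1 cap (k + 1) H τ).p : ℝ) Finset.univ
        (fun Q => cap < Q.card) ≤ 1 / 6 := hsize
      have h7 := (h1.trans h4).trans (h2.trans h5)
      change _ + subsetProb (p : ℝ) _ _ ≤ _
      linarith
    · rw [not_or, not_lt, not_le, m.subsetExp_estimate hp0'.ne'] at hQ
      refine ⟨hQ.1, congrArg PMF.pure (decide_eq_true (p := m.Reaches p (k + 1) H τ Q _) ?_)⟩
      exact ⟨j, hj, x, fun _ _ => rfl, by linarith [hQ.2]⟩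
  -- All strings that agree with `x` off the kernel: the range of the union bound.
  · set Y : ℕ → Finset (Fin n → A) := fun j =>
      Fintype.piFinset fun i => if i ∈ H (j + 1) then Finset.univ else {x i} with hY
    have hYcard : ∀ j, (Y j).card = Fintype.card A ^ (H (j + 1)).card := by
      intro j
      rw [hY, Fintype.card_piFinset, Finset.prod_congr rfl (g := fun i =>
        if i ∈ H (j + 1) then Fintype.card A else 1) (fun i _ => by split_ifs <;> simp),
        Finset.prod_ite]
      simp
    refine SampleAlg.le_output _ x false (fun Q => cap < Q.card ∨
      ∃ j ∈ Finset.range (k + 1), ∃ y ∈ Y j,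
        subsetExp p Finset.univ (m.estimate p (H j) (H (j + 1)) y) + η ≤
          m.estimate p (H j) (H (j + 1)) y Q) ?_ fun Q hQ => ?_
    · refine (subsetProb_or_le hp0'.le hp1' _ _).trans ?_
      have h6 : subsetProb ((m.sampler p hp1 cap (k + 1) H τ).p : ℝ) Finset.univ
        (fun Q => cap < Q.card) ≤ 1 / 6 := hsize
      have h1 : ∀ j ∈ Finset.range (k + 1), subsetProb (p : ℝ) Finset.univ (fun Q => ∃ y ∈ Y j,
          subsetExp p Finset.univ (m.estimate p (H j) (H (j + 1)) y) + η ≤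
            m.estimate p (H j) (H (j + 1)) y Q) ≤ 1 / (6 * (k + 1)) := by
        intro j hj
        refine ((subsetProb_exists_le hp0'.le hp1' _ _).trans
          (Finset.sum_le_card_nsmul _ _ (Real.exp (-(η ^ 2 / (2 * V j)))) fun y _ => ?_)).trans ?_
        · exact subsetProb_upper_tail hp0'.le hp1' Finset.univ
            (m.influence p k (H j) y) (m.estimate p (H j) (H (j + 1)) y)
            (fun Q i _ => m.abs_estimate_sub_le hk hp0' hp1' _ _ y Q i)
            (hV0 j) (m.sum_influence_sq_le hk hp0' (hθ0 j).le (hθ j) y) hη0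
        · rw [nsmul_eq_mul, hYcard]
          push_cast
          exact htail j hj
      have h2 := (subsetProb_exists_le hp0'.le hp1' (Finset.range (k + 1)) _).trans
        (Finset.sum_le_card_nsmul _ _ _ h1)
      rw [Finset.card_range, nsmul_eq_mul] at h2
      have h3 : ((k + 1 : ℕ) : ℝ) * (1 / (6 * (k + 1))) = 1 / 6 := by
        push_cast; field_simp
      rw [h3] at h2
      change _ + subsetProb (p : ℝ) _ _ ≤ _
      linarith
    · rw [not_or, not_lt] at hQ
      refine ⟨hQ.1, congrArg PMF.pure (decide_eq_false (p := m.Reaches p (k + 1) H τ Q _) ?_)⟩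
      rintro ⟨j, hj, y, hy, hyτ⟩
      -- The witness `y` is arbitrary off the kernel and the sample; resetting it to `x` off the
      -- kernel preserves the estimate and lands in `Y j`.
      refine hQ.2 ⟨j, hj, fun i => if i ∈ H (j + 1) then y i else x i, ?_, ?_⟩
      · rw [hY, Fintype.mem_piFinset]
        intro i
        split_ifs <;> simp
      · rw [m.subsetExp_estimate hp0'.ne', m.estimate_congr p (H j) (H (j + 1)) Q (z := y)]
        · have hfar : IsFar (ε - ε / 2) P (fun i => if i ∈ H (j + 1) then y i else x i) :=
            hx.of_eq_off (H (j + 1)) (hsmall j hj) (by linarith) fun i hi => if_neg hi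
          rw [sub_half] at hfar
          have := (m.acceptProb_le_prob (H j) (H (j + 1)) _).trans (hrej _ hfar)
          refine le_trans ?_ hyτ
          linarith
        · intro i hi
          split_ifs with hiK
          · rfl
          · rcases hi with hi | hi
            · exact absurd hi hiK
            · exact (hy ⟨i, hi⟩ hiK).symm

end Daisies

/-! ### Choice of parameters and numerical estimates. -/

section Parameters

/-- The target error depends on the number of votes, but only polynomially. Here 84 = 6 · 14: the
inverse error is at most 2^(14 l), and (9/8)^6 ≥ 2. -/
theorem four_mul_votes_le {l m : ℕ} (hl : 1 ≤ l) (hm : 1 ≤ m) (hml : m ≤ 2 ^ l) :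
    ((8 : ℝ) / 9) ^ (84 * l) ≤ 1 / (4 * ((2 * (84 * l) * m : ℕ) + 1)) := by
  have h1 : (4 * ((2 * (84 * l) * m : ℕ) + 1) : ℝ) ≤ 2 ^ (14 * l) := by
    have e1 : l ≤ 2 ^ l := Nat.lt_two_pow_self.le
    have e2 : 4096 ≤ 2 ^ (12 * l) := by
      calc 4096 = 2 ^ (12 * 1) := by norm_num
        _ ≤ _ := Nat.pow_le_pow_right (by norm_num) (by omega)
    have e3 : l * m * 4096 ≤ 2 ^ l * 2 ^ l * 2 ^ (12 * l) :=
      Nat.mul_le_mul (Nat.mul_le_mul e1 hml) e2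
    have e4 : 1 ≤ l * m := Nat.mul_pos hl hm
    have e5 : 4 * (2 * (84 * l) * m + 1) ≤ 2 ^ (14 * l) := by
      calc 4 * (2 * (84 * l) * m + 1) = 672 * (l * m) + 4 := by ring
        _ ≤ l * m * 4096 := by omega
        _ ≤ _ := e3
        _ = 2 ^ (14 * l) := by rw [← pow_add, ← pow_add]; congr 1; ring
    exact_mod_cast e5
  have h2 : (2 : ℝ) ^ (14 * l) ≤ (9 / 8) ^ (84 * l) := by
    rw [show 84 * l = 6 * (14 * l) by ring, pow_mul (9 / 8 : ℝ)]
    gcongr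
    norm_num
  rw [show ((8 : ℝ) / 9) = (9 / 8)⁻¹ by norm_num, inv_pow, ← one_div]
  exact one_div_le_one_div_of_le (by positivity) (h1.trans h2)

theorem clog_two_le_log {m : ℕ} (hm : 2 ≤ m) : (Nat.clog 2 m : ℝ) ≤ 3 * Real.log m := by
  have hlog2 : 0.6931471803 < Real.log 2 := Real.log_two_gt_d9
  have hm' : (2 : ℝ) ≤ m := by exact_mod_cast hm
  have h1 : Real.log 2 ≤ Real.log m := Real.log_le_log (by norm_num) hm'
  have hc : 1 ≤ Nat.clog 2 m := Nat.clog_pos (by norm_num) hm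
  have h2 : 2 ^ (Nat.clog 2 m - 1) < m := Nat.pow_pred_clog_lt_self (by norm_num) hm
  have h3 : (2 : ℝ) ^ (Nat.clog 2 m - 1) ≤ m := by exact_mod_cast h2.le
  have h4 := Real.log_le_log (by positivity) h3
  rw [Real.log_pow, Nat.cast_sub hc, Nat.cast_one] at h4
  have h5 : (0 : ℝ) ≤ Nat.clog 2 m := Nat.cast_nonneg _
  nlinarith

theorem le_rpow_one_div {a x : ℝ} (ha : 0 ≤ a) (hx : 0 ≤ x) {r : ℕ} (hr : 0 < r)
    (h : a ^ r ≤ x) : a ≤ x ^ (1 / (r : ℝ)) := by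
  rw [one_div, Real.le_rpow_inv_iff_of_pos ha hx (by exact_mod_cast hr), Real.rpow_natCast]
  exact h

/-- The bounded differences tail beats the number of assignments to a kernel of size at
most `N`. -/
theorem card_pow_mul_exp_le {a c : ℕ} (ha : 1 ≤ a) {N L E : ℝ} (hN : 1 ≤ N) (hcN : (c : ℝ) ≤ N)
    (hL : 1 ≤ L) (hE : N * (7 * L * a) ≤ E) :
    (a : ℝ) ^ c * Real.exp (-E) ≤ 1 / (6 * L) := by
  have ha' : (1 : ℝ) ≤ a := by exact_mod_cast ha
  have h1 : (a : ℝ) ^ c ≤ Real.exp (N * (L * a)) := by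
    -- The budget 7 in `hE` splits as 1 for the assignments and 6 for the factor `6 * L`.
    have e1 : (a : ℝ) ≤ Real.exp a := by linarith [Real.add_one_le_exp (a : ℝ)]
    calc (a : ℝ) ^ c ≤ Real.exp a ^ c := by gcongr
      _ = Real.exp (c * a) := by rw [← Real.exp_nat_mul]
      _ ≤ _ := by
        refine Real.exp_le_exp.2 (mul_le_mul hcN ?_ (by positivity) (by positivity))
        exact le_mul_of_one_le_left (by positivity) hL
  have h2 : 6 * L ≤ Real.exp (N * (6 * L * a)) := by
    have e1 : 6 * L ≤ 6 * L * a := le_mul_of_one_le_right (by positivity) ha'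
    have e2 : 6 * L * a ≤ N * (6 * L * a) := le_mul_of_one_le_left (by positivity) hN
    linarith [Real.add_one_le_exp (N * (6 * L * a))]
  rw [le_div_iff₀ (by positivity)]
  calc (a : ℝ) ^ c * Real.exp (-E) * (6 * L)
      ≤ Real.exp (N * (L * a)) * Real.exp (-E) * Real.exp (N * (6 * L * a)) := by gcongr
    _ = Real.exp (N * (7 * L * a) - E) := by
        rw [← Real.exp_add, ← Real.exp_add]; ring_nf
    _ ≤ 1 := Real.exp_le_one_iff.2 (by linarith)

/-- The first factor on the right is the bound on the kernel size. Of the gap n^(1/L) between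
consecutive thresholds, half is spent on inverse sampling probabilities and n^(1/(2L)) survives. -/
theorem inv_tail_exponent {n : ℝ} (hn : 0 < n) {k L j B : ℝ} (hk : 0 < k) (hL : 0 < L)
    (hB : 0 < B) :
    (1 / (4 * L)) ^ 2 / (2 * (n ^ (1 / (2 * L)) * (B * n ^ (-1 + j / L) * k))) =
      n ^ (1 - (j + 1) / L) * (n ^ (1 / (2 * L)) / (32 * L ^ 2 * k * B)) := by
  have h : n ^ (1 / (2 * L)) * n ^ (-1 + j / L) *
      (n ^ (1 - (j + 1) / L) * n ^ (1 / (2 * L))) = 1 := by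
    rw [← Real.rpow_add hn, ← Real.rpow_add hn, ← Real.rpow_add hn]
    convert Real.rpow_zero n using 2
    field_simp
    ring
  have h1 : 0 < n ^ (1 / (2 * L)) := by positivity
  have h2 : 0 < n ^ (-1 + j / L) := by positivity
  rw [div_eq_iff (by positivity)]
  generalize n ^ (1 / (2 * L)) = x at *
  generalize n ^ (-1 + j / L) = y at *
  generalize n ^ (1 - (j + 1) / L) = z at *
  calc (1 / (4 * L)) ^ 2 = (1 / (4 * L)) ^ 2 * (x * y * (z * x)) := by rw [h, mul_one]
    _ = _ := by field_simp; ring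

/-- The tester for one fixed input length, in terms of the number `k` of queries after
amplification. -/
theorem sampleTestable_of_testable {n : ℕ} {A : Type*} [Fintype A] [Nonempty A]
    {P : Set (Fin n → A)} {ε : ℝ} (hε : 0 < ε) {q l m : ℕ} (hl : 1 ≤ l) (hm : 1 ≤ m)
    (hqm : q ≤ m) (hml : m ≤ 2 ^ l) (hP : Testable (ε / 2) q P) {k : ℕ}
    (hk : k = 2 * (84 * l) * m) (hn : 1 ≤ n)
    (hn1 : 224 * (k + 1 : ℝ) ^ 5 ≤ (n : ℝ) ^ (1 / ((4 * (k + 1) : ℕ) : ℝ)))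
    (hn2 : (Fintype.card A : ℝ) ^ (q + 1) ≤ (n : ℝ) ^ (1 / ((4 * (k + 1) : ℕ) : ℝ)))
    (hn3 : 2 / ε ≤ (n : ℝ) ^ (1 / ((k + 1 : ℕ) : ℝ)))
    (hn4 : 6 ≤ (n : ℝ) ^ (1 / ((8 * (k * (k + 1)) : ℕ) : ℝ)))
    {e : ℝ} (he : e ≤ 1 / ((8 * (k * (k + 1)) : ℕ) : ℝ)) :
    SampleTestable ε ((n : ℝ) ^ (1 - e)) P := by
  obtain ⟨M, hMq, hMa, hMr⟩ := hP
  have hn' : (1 : ℝ) ≤ n := by exact_mod_cast hn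
  have hn0 : (0 : ℝ) < n := by linarith
  have hA : 1 ≤ Fintype.card A := Fintype.card_pos
  have hA' : (1 : ℝ) ≤ Fintype.card A := by exact_mod_cast hA
  have hk0 : 0 < k := by rw [hk]; positivity
  have hk0' : (0 : ℝ) < k := by exact_mod_cast hk0
  set L : ℝ := k + 1 with hL
  have hL1 : 1 ≤ L := by linarith
  have hL0 : 0 < L := by linarith
  set u := 84 * l
  set mo := (M.model q).majority u
  have hq : ∀ ω x, (mo.queries ω x).card ≤ k := fun ω x =>
    (QueryModel.majority_card_queries_le (fun τ x => τ.2.2.1 x) u ω x).trans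
      (hk ▸ Nat.mul_le_mul_left _ hqm)
  set B : ℕ := k * Fintype.card A ^ q with hB
  have hB0 : (0 : ℝ) < B := by
    have : 0 < B := by positivity
    exact_mod_cast this
  have hreach : ∀ ω, (mo.reach ω).card ≤ B := fun ω =>
    (QueryModel.majority_card_reach_le (fun τ => τ.2.2.2) u ω).trans (by
      rw [hB, hk, ← mul_assoc]
      exact Nat.mul_le_mul_right _ (Nat.mul_le_mul_left _ hqm))
  -- The factor `B` cancels in Markov's inequality, leaving a clean power of `n` in `hHcard`.
  set θ : ℕ → ℝ := fun j => B * (n : ℝ) ^ (-1 + j / L) with hθ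
  have hθ0 : ∀ j, 0 < θ j := fun j => by positivity
  have hθm : Monotone θ := fun i j hij => by
    have : (i : ℝ) ≤ j := by exact_mod_cast hij
    simp only [hθ]
    gcongr
  set H : ℕ → Finset (Fin n) := fun j => mo.heavy (θ j) with hH
  have hHanti : Antitone H := fun i j hij => mo.heavy_anti (hθm hij)
  have hHcard : ∀ j : ℕ, ((H (j + 1)).card : ℝ) ≤ (n : ℝ) ^ (1 - (j + 1) / L) := by
    intro j
    have h := QueryModel.card_heavy_mul_le hreach (θ (j + 1))
    have hinv : (n : ℝ) ^ (1 - (j + 1) / L) * (n : ℝ) ^ (-1 + (j + 1 : ℕ) / L) = 1 := by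
      rw [← Real.rpow_add hn0]
      convert Real.rpow_zero (n : ℝ) using 2
      push_cast
      ring
    have h2 : 0 < (n : ℝ) ^ (-1 + (j + 1 : ℕ) / L) := by positivity
    refine le_of_mul_le_mul_right ?_ (mul_pos hB0 h2)
    calc _ ≤ (B : ℝ) := h
      _ = (n : ℝ) ^ (1 - (j + 1) / L) * (B * (n : ℝ) ^ (-1 + (j + 1 : ℕ) / L)) := by
        rw [mul_left_comm, hinv, mul_one]
  have hjL : ∀ j ∈ Finset.range (k + 1), (j + 1 : ℝ) / L ≤ 1 := fun j hj => by
    rw [div_le_one hL0]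
    have : j ≤ k := Nat.lt_succ_iff.1 (Finset.mem_range.1 hj)
    have : (j : ℝ) ≤ k := by exact_mod_cast this
    linarith
  -- Chosen so that p^(-2k) = n^(1/(2L)).
  set s : ℝ := 1 / (4 * (k * L)) with hs
  have hs0 : 0 < s := by positivity
  set p : ℝ≥0 := ⟨(n : ℝ) ^ (-s), by positivity⟩ with hp
  have hpv : (p : ℝ) = (n : ℝ) ^ (-s) := rfl
  have hp0 : 0 < p := by
    rw [← NNReal.coe_pos, hpv]; positivity
  have hp1 : p ≤ 1 := by
    rw [← NNReal.coe_le_coe, hpv]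
    exact Real.rpow_le_one_of_one_le_of_nonpos hn' (by linarith)
  have hppow : ((p : ℝ)⁻¹ ^ k) ^ 2 = (n : ℝ) ^ (1 / (2 * L)) := by
    rw [hpv, ← Real.rpow_neg hn0.le, neg_neg, ← pow_mul, ← Real.rpow_mul_natCast hn0.le, hs]
    congr 1
    push_cast
    field_simp
    ring
  have herr := four_mul_votes_le hl hm hml
  rw [← hk] at herr
  have hprob : ∀ x b, 2 / 3 ≤ M.output x b → mo.prob x (!b) ≤ 1 / (4 * (k + 1)) := by
    intro x b h
    refine (QueryModel.majority_prob_le ?_ u).trans herr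
    rw [QueryAlg.model_prob hMq]
    have h2 := ENNReal.toReal_mono (PMF.apply_ne_top _ _) h
    rw [ENNReal.toReal_div] at h2
    exact h2
  refine mo.sampleTestable hq hk0 hHanti hθ0
    (fun j i hi => QueryModel.touch_le_of_notMem_heavy hi) hp0 hp1
    (cap := ⌊(n : ℝ) ^ (1 - e)⌋₊) hε.le ?_ ?_ ?_ (fun x hx => hprob x true (hMa x hx))
    (fun x hx => hprob x false (hMr x hx)) (Nat.floor_le (by positivity))
  -- The cap uses only half of the saving `s`; the other half absorbs the factor 6 in Markov's
  -- inequality for the sample size.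
  · have hs2 : s = 2 * (1 / ((8 * (k * (k + 1)) : ℕ) : ℝ)) := by
      rw [hs, hL]; push_cast; field_simp; norm_num
    set s' : ℝ := 1 / ((8 * (k * (k + 1)) : ℕ) : ℝ)
    have hcap : (n : ℝ) ^ (1 - e) ≤ (⌊(n : ℝ) ^ (1 - e)⌋₊ : ℝ) + 1 := (Nat.lt_floor_add_one _).le
    rw [div_le_iff₀ (by positivity)]
    calc (n : ℝ) * p = (n : ℝ) ^ (1 - s) := by
          rw [hpv, sub_eq_add_neg, Real.rpow_add hn0, Real.rpow_one]
      _ ≤ 1 / 6 * ((n : ℝ) ^ s' * (n : ℝ) ^ (1 - s)) := by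
          have : 0 < (n : ℝ) ^ (1 - s) := by positivity
          nlinarith
      _ ≤ 1 / 6 * (n : ℝ) ^ (1 - e) := by
          rw [← Real.rpow_add hn0]
          gcongr
          linarith
      _ ≤ _ := by gcongr
  · intro j hj
    have hN : 1 ≤ (n : ℝ) ^ (1 - (j + 1) / L) :=
      Real.one_le_rpow hn' (by linarith [hjL j hj])
    refine card_pow_mul_exp_le hA hN (hHcard j) hL1 ?_
    rw [hppow, hθ, inv_tail_exponent hn0 hk0' hL0 hB0]
    refine mul_le_mul_of_nonneg_left ?_ (by positivity)
    rw [le_div_iff₀ (by positivity)]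
    -- One half absorbs the polynomial in `L`, the other the power of the alphabet size.
    have hsq : (n : ℝ) ^ (1 / (2 * L)) =
        (n : ℝ) ^ (1 / ((4 * (k + 1) : ℕ) : ℝ)) * (n : ℝ) ^ (1 / ((4 * (k + 1) : ℕ) : ℝ)) := by
      rw [← Real.rpow_add hn0, hL]
      congr 1
      push_cast
      field_simp
      norm_num
    have hkL : (k : ℝ) ≤ L := by linarith
    calc 7 * L * (Fintype.card A : ℝ) * (32 * L ^ 2 * k * B)
        = 224 * (L ^ 3 * k ^ 2) * (Fintype.card A : ℝ) ^ (q + 1) := by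
          rw [hB]; push_cast; ring
      _ ≤ 224 * (L ^ 3 * L ^ 2) * (Fintype.card A : ℝ) ^ (q + 1) := by gcongr
      _ = 224 * L ^ 5 * (Fintype.card A : ℝ) ^ (q + 1) := by ring
      _ ≤ _ := by rw [hsq]; gcongr
  · intro j hj
    refine (hHcard j).trans ?_
    have h1 : (n : ℝ) ^ (1 - (j + 1) / L) ≤ (n : ℝ) ^ (1 - 1 / L) := by
      gcongr
      linarith [(Nat.cast_nonneg j : (0 : ℝ) ≤ j)]
    refine h1.trans ?_
    rw [Real.rpow_sub hn0, Real.rpow_one, div_le_iff₀ (by positivity)]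
    rw [Nat.cast_add, Nat.cast_one, ← hL, div_le_iff₀ hε] at hn3
    nlinarith

/-- Here 504 = 168 · 3, with the 3 from `clog_two_le_log`, and 4064256 = 16 · 504^2. -/
theorem two_mul_queries_le {m : ℕ} (hm : 2 ≤ m) {k : ℕ}
    (hk : k = 2 * (84 * Nat.clog 2 m) * m) :
    1 / (4064256 * (m : ℝ) ^ 2 * Real.log m ^ 2) ≤ 1 / ((8 * (k * (k + 1)) : ℕ) : ℝ) := by
  have hc : 1 ≤ Nat.clog 2 m := Nat.clog_pos (by norm_num) hm
  have hk0 : 1 ≤ k := by rw [hk]; exact Nat.mul_pos (by omega) (by omega)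
  have hk0' : (1 : ℝ) ≤ k := by exact_mod_cast hk0
  have hkle : (k : ℝ) ≤ 504 * (m * Real.log m) := by
    have h := mul_le_mul_of_nonneg_left (clog_two_le_log hm) (Nat.cast_nonneg (α := ℝ) m)
    rw [hk]
    push_cast
    linarith
  refine one_div_le_one_div_of_le (by positivity) ?_
  push_cast
  calc (8 : ℝ) * (k * (k + 1)) ≤ 16 * k ^ 2 := by nlinarith
    _ ≤ 16 * (504 * (m * Real.log m)) ^ 2 := by gcongr
    _ = _ := by ring

end Parameters

end LocalAlg

/-! ### The theorem: choice of the constant and of the threshold `n₀`. -/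

theorem corollary7p1 :
    ∃ C : ℝ, 0 < C ∧ ∀ (ε : ℝ) (_ : 0 < ε) (q : ℕ), ∃ n₀ : ℕ, ∀ n : ℕ, n₀ ≤ n →
      ∀ (A : Type*) [Fintype A] (_ : Fintype.card A ^ n₀ ≤ n) (P : Set (Fin n → A)),
        LocalAlg.Testable (ε / 2) q P →
          LocalAlg.SampleTestable ε
            ((n : ℝ) ^ (1 - 1 / (C * ((max q 2 : ℕ) : ℝ) ^ 2 *
              Real.log ((max q 2 : ℕ) : ℝ) ^ 2))) P := by
  refine ⟨4064256, by norm_num, fun ε hε q => ?_⟩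
  obtain ⟨m, hm⟩ : ∃ m, m = max q 2 := ⟨_, rfl⟩
  have hm2 : 2 ≤ m := hm ▸ le_max_right _ _
  have hqm : q ≤ m := hm ▸ le_max_left _ _
  rw [← hm]
  obtain ⟨k, hk⟩ : ∃ k, k = 2 * (84 * Nat.clog 2 m) * m := ⟨_, rfl⟩
  have hc : 1 ≤ Nat.clog 2 m := Nat.clog_pos (by norm_num) hm2
  have hk0 : 0 < k := by rw [hk]; exact Nat.mul_pos (by omega) (by omega)
  obtain ⟨n₀, h1, h2, h3, h4, h5⟩ : ∃ N : ℕ, 1 ≤ N ∧ (224 * (k + 1) ^ 5) ^ (4 * (k + 1)) ≤ N ∧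
      (q + 1) * (4 * (k + 1)) ≤ N ∧ ⌈(2 / ε) ^ (k + 1)⌉₊ ≤ N ∧ 6 ^ (8 * (k * (k + 1))) ≤ N := by
    have h : ∀ a b c d : ℕ, ∃ N : ℕ, 1 ≤ N ∧ a ≤ N ∧ b ≤ N ∧ c ≤ N ∧ d ≤ N :=
      fun a b c d => ⟨1 + a + b + c + d, by omega⟩
    exact h _ _ _ _
  refine ⟨n₀, fun n hn A _ hA P hP => ?_⟩
  have hn1 : 1 ≤ n := h1.trans hn
  -- Over an empty alphabet there are no strings of length `n ≥ 1`, so any sampler with cap 0 works.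
  rcases isEmpty_or_nonempty A with hAe | hAn
  · refine ⟨⟨0, zero_le_one, 0, fun _ _ => PMF.pure true, fun _ => PMF.pure true⟩, ?_, ?_, ?_⟩
    · simpa using by positivity
    · exact fun x => hAe.elim (x ⟨0, hn1⟩)
    · exact fun x => hAe.elim (x ⟨0, hn1⟩)
  have hA1 : 1 ≤ Fintype.card A := Fintype.card_pos
  refine LocalAlg.sampleTestable_of_testable hε hc (by omega) hqm (Nat.le_pow_clog (by norm_num) m)
    hP hk hn1 ?_ ?_ ?_ ?_ (LocalAlg.two_mul_queries_le hm2 hk)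
  · refine LocalAlg.le_rpow_one_div (by positivity) (Nat.cast_nonneg n) (by positivity) ?_
    have : (224 * (k + 1) ^ 5) ^ (4 * (k + 1)) ≤ n := h2.trans hn
    exact_mod_cast this
  · refine LocalAlg.le_rpow_one_div (by positivity) (Nat.cast_nonneg n) (by positivity) ?_
    rw [← pow_mul]
    have : Fintype.card A ^ ((q + 1) * (4 * (k + 1))) ≤ n :=
      (Nat.pow_le_pow_right hA1 h3).trans hA
    exact_mod_cast this
  · refine LocalAlg.le_rpow_one_div (by positivity) (Nat.cast_nonneg n) (by positivity) ?_
    refine (Nat.le_ceil _).trans ?_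
    have : ⌈(2 / ε) ^ (k + 1)⌉₊ ≤ n := h4.trans hn
    exact_mod_cast this
  · refine LocalAlg.le_rpow_one_div (by positivity) (Nat.cast_nonneg n) (by positivity) ?_
    have : 6 ^ (8 * (k * (k + 1))) ≤ n := h5.trans hn
    exact_mod_cast this
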